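/- Let $\mathbb{H}$ be the real algebra of quaternions, $\mathbb{S}=\{I\in\mathbb{H}: I^2=-1\}$, $L_I=\mathbb{R}+\mathbb{R}I$ for $I\in\mathbb{S}$, and let $\widehat{\mathbb{H}}=\mathbb{H}\cup\{\infty\}$ be the one-point compactification. For a function $f$ on $\mathbb{H}$ let $f_I=f|_{L_I}$; where it takes finite values, $f_I$ is called holomorphic if it is real differentiable and $\frac12\left(\frac{\partial}{\partial x}+I\frac{\partial}{\partial y}\right)f_I(x+yI)=0$. A function $f:\mathbb{H}\to\widehat{\mathbb{H}}$ is \emph{semiregular} if for every $I\in\mathbb{S}$ the restriction $f_I$ is meromorphic: each $p\in L_I$ either has a neighbourhood in $L_I$ on which $f_I$ is finite and holomorphic, or satisfies $f(p)=\infty$ and has a punctured disc in $L_I$ around it on which $f_I$ is finite, holomorphic and equal to a Laurent series $f_I(z)=\sum_{k\in\mathbb{Z}}(z-p)^k a_k$, $a_k\in\mathbb{H}$, with only finitely many nonzero coefficients of negative index. For convergent power series $f(q)=\sum_n q^n a_n$, $g(q)=\sum_n q^n b_n$ put $(f*g)(q)=\sum_n q^n\sum_{k=0}^n a_k b_{n-k}$,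 $f^c(q)=\sum_n q^n\overline{a_n}$, $f^s=f*f^c$, and $(f^{-*}*g)(q)=f^s(q)^{-1}\,(f^c*g)(q)$ wherever $f^s(q)\neq0$. For $A=\begin{pmatrix}a&c\\ b&d\end{pmatrix}\in GL(2,\mathbb{H})$ the \emph{regular fractional transformation} associated to $A$ is $\mathcal{F}_A(q)=(qc+d)^{-*}*(qa+b)$. \textbf{Theorem.} Let $f:\widehat{\mathbb{H}}\to\widehat{\mathbb{H}}$ be continuous and injective, and let $f|_{\mathbb{H}}$ be semiregular. Then one of the following holds. (1) $f$ is a regular affine transformation: there are $a,b\in\mathbb{H}$ with $a\neq0$ such that $f(q)=qa+b$ for all $q\in\mathbb{H}$, and $f(\infty)=\infty$. (2) $f$ is a regular fractional transformation with its pole at a real point: there are $x\in\mathbb{R}$ and $a,b\in\mathbb{H}$ with $a\neq0$ such that the matrix $\begin{pmatrix}b&1\\ a-xb&-x\end{pmatrix}$ is invertible, $f(x)=\infty$, $f(\infty)=b$, and every $q\in\mathbb{H}\setminus\{x\}$ lies in the domain of definition of the associated regular fractional transformation, with $$f(q)=(q-x)^{-*}*(qb+a-xb).$$ -/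

import Mathlib

open scoped Quaternion

noncomputable section

namespace SliceRegular

/-- The one-point (Alexandroff) compactification `ℍ ∪ {∞}` of the quaternions. -/
abbrev HHat : Type := OnePoint ℍ[ℝ]

/-- The 2-sphere `𝕊` of quaternionic imaginary units. -/
def imaginaryUnits : Set ℍ[ℝ] := {I | I ^ 2 = -1}

/-- The parametrization `x + i y ↦ x + y I` of the complex line `L_I = ℝ + ℝ I`. -/
def slice (I : ℍ[ℝ]) (z : ℂ) : ℍ[ℝ] := (z.re : ℍ[ℝ]) + (z.im : ℍ[ℝ]) * I

/-- The operator `½ (∂/∂x + I ∂/∂y)`, applied to a function `g` of `x + y I ∈ L_I`,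
written in the coordinate `x + i y ∈ ℂ`. -/
def dbar (I : ℍ[ℝ]) (g : ℂ → ℍ[ℝ]) (z : ℂ) : ℍ[ℝ] :=
  (1 / 2 : ℝ) • (fderiv ℝ g z 1 + I * fderiv ℝ g z Complex.I)

/-- `f_I` takes finite values on the open subset `U` of `L_I ≅ ℂ`, where it is real
differentiable and holomorphic, i.e. `½ (∂/∂x + I ∂/∂y) f_I = 0`. The function `g` is `f_I`, seen
as `ℍ`-valued on `U`. -/
def IsRegularOnSlice (I : ℍ[ℝ]) (f : ℍ[ℝ] → HHat) (g : ℂ → ℍ[ℝ]) (U : Set ℂ) : Prop :=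
  (∀ z ∈ U, f (slice I z) = ((g z : ℍ[ℝ]) : HHat)) ∧
    DifferentiableOn ℝ g U ∧ ∀ z ∈ U, dbar I g z = 0

/-- The point `p` of `L_I` is a non-essential isolated singularity of `f_I`: on a punctured disc
around `p`, `f_I` is finite and regular, and it has a Laurent expansion `∑ (z - p)^k a_k` in which
`a_{-m} = 0` for all sufficiently large `m` (a pole, of order `0` if removable). -/
def IsPoleOnSlice (I : ℍ[ℝ]) (f : ℍ[ℝ] → HHat) (p : ℂ) : Prop :=
  ∃ R : ℝ, 0 < R ∧ ∃ g : ℂ → ℍ[ℝ],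
    IsRegularOnSlice I f g (Metric.ball p R \ {p}) ∧
    ∃ a : ℤ → ℍ[ℝ], (∃ n : ℕ, ∀ m : ℕ, n < m → a (-(m : ℤ)) = 0) ∧
      ∀ z ∈ Metric.ball p R \ {p},
        HasSum (fun k : ℤ => (slice I z - slice I p) ^ k * a k) (g z)

/-- `f : ℍ → ℍ ∪ {∞}` is semiregular on `ℍ`: for every imaginary unit `I`, the restriction `f_I`
is meromorphic, i.e. each point of `L_I` either has a neighbourhood in `L_I` on which `f_I` is
finite and regular, or is a point with value `∞` that is not an essential singularity. -/
def IsSemiregular (f : ℍ[ℝ] → HHat) : Prop :=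
  ∀ I ∈ imaginaryUnits, ∀ p : ℂ,
    (∃ R : ℝ, 0 < R ∧ ∃ g : ℂ → ℍ[ℝ], IsRegularOnSlice I f g (Metric.ball p R)) ∨
      (f (slice I p) = OnePoint.infty ∧ IsPoleOnSlice I f p)

/-- The value `∑ qⁿ aₙ` at `q` of the power series with coefficients `aₙ`. Regular functions on
`ℍ` are identified with everywhere convergent power series; multiplication of formal power
series over `ℍ` (with central variable) is then the regular product `*`. -/
def value (F : PowerSeries ℍ[ℝ]) (q : ℍ[ℝ]) : ℍ[ℝ] :=
  ∑' n : ℕ, q ^ n * PowerSeries.coeff n F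

/-- The regular conjugate `f^c(q) = ∑ qⁿ conj(aₙ)`. -/
def conj (F : PowerSeries ℍ[ℝ]) : PowerSeries ℍ[ℝ] :=
  PowerSeries.mk fun n => star (PowerSeries.coeff n F)

/-- The symmetrization `f^s = f * f^c`. -/
def symmetrization (F : PowerSeries ℍ[ℝ]) : PowerSeries ℍ[ℝ] := F * conj F

/-- The domain of definition of the regular quotients `f^{-*} * g`: the complement of the
zero set of `f^s`. -/
def quotientDomain (F : PowerSeries ℍ[ℝ]) : Set ℍ[ℝ] := {q | value (symmetrization F) q ≠ 0}

/-- The left regular quotient `(f^{-*} * g)(q) = f^s(q)⁻¹ (f^c * g)(q)`, meaningful for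
`q ∈ quotientDomain F`. -/
def regularQuotient (F G : PowerSeries ℍ[ℝ]) (q : ℍ[ℝ]) : ℍ[ℝ] :=
  (value (symmetrization F) q)⁻¹ * value (conj F * G) q

/-- The regular function `q ↦ q c + d`. -/
def linear (c d : ℍ[ℝ]) : PowerSeries ℍ[ℝ] :=
  PowerSeries.X * PowerSeries.C c + PowerSeries.C d

/-- The domain of definition in `ℍ` of the regular fractional transformation of
`A = (a c; b d)`. -/
def fractionalDomain (A : (Matrix (Fin 2) (Fin 2) ℍ[ℝ])ˣ) : Set ℍ[ℝ] :=
  quotientDomain (linear (A.val 0 1) (A.val 1 1))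

/-- The regular fractional transformation `𝓕_A(q) = (q c + d)^{-*} * (q a + b)` of
`A = (a c; b d) ∈ GL(2, ℍ)`. -/
def regularFractional (A : (Matrix (Fin 2) (Fin 2) ℍ[ℝ])ˣ) (q : ℍ[ℝ]) : ℍ[ℝ] :=
  regularQuotient (linear (A.val 0 1) (A.val 1 1)) (linear (A.val 0 0) (A.val 1 0)) q

/-- `f` is the regular affine transformation `q ↦ q a + b` with `a ≠ 0`, extended by `∞ ↦ ∞`. -/
def IsRegularAffine (f : HHat → HHat) : Prop :=
  f OnePoint.infty = OnePoint.infty ∧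
    ∃ a b : ℍ[ℝ], a ≠ 0 ∧ ∀ q : ℍ[ℝ], f (q : HHat) = ((q * a + b : ℍ[ℝ]) : HHat)

end SliceRegular

end

noncomputable section

namespace SliceRegular

/-! Everything reduces to an injective regular function `h` on `ℍ` that tends to infinity at
infinity. It is a power series, and its four real coordinates, extended to `ℂ`, are entire functions
`uᵢ`. Their symmetrization `φ = ∑ uᵢ²` satisfies `|φ(z)| = |h(p)| |h(q)|` for two points `p`, `q` of
norm `|z|` (`exists_norm_complexSymmetrization`). After subtraction of `h 0`, therefore, `φ`
vanishes at most at `0` and tends to infinity, so `φ(z) = c z^m` by a Liouville argument. Growth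
makes each `uᵢ` a polynomial. On the real axis a sum of real squares is then a monomial, which
forces all `uᵢ` to be monomials of one degree (`exists_eq_monomial_of_sum_sq`). Thus `h(q) - h(0) =
q^n b`, and injectivity on roots of unity leaves `n = 1`.

If `f` fixes infinity, this applies to `f` itself. If `f(∞) = b` is finite, Liouville gives a pole
on every slice; by injectivity all these poles are one point, which is real because two slices meet
only in `ℝ`. Inverting about that point `x`, the function `f(x + q⁻¹)` has a removable singularity
at `0` with value `b`, and it is affine by the first case. -/

theorem mem_imaginaryUnits_iff {I : ℍ[ℝ]} :
    I ∈ imaginaryUnits ↔ I.re = 0 ∧ I.imI ^ 2 + I.imJ ^ 2 + I.imK ^ 2 = 1 := by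
  constructor
  · intro h
    have h' : I ^ 2 = -1 := h
    have hn : ‖I‖ ^ 2 = 1 := by rw [← norm_pow, h']; simp
    have hs : Quaternion.normSq I = 1 := by
      rw [Quaternion.normSq_eq_norm_mul_self]; nlinarith
    have hre : I.re = 0 := by
      rw [← Quaternion.sq_eq_neg_normSq, hs, h']; simp
    refine ⟨hre, ?_⟩
    rw [Quaternion.normSq_def', hre] at hs
    linarith
  · rintro ⟨h0, h1⟩
    change I ^ 2 = -1
    rw [Quaternion.sq_eq_neg_normSq.2 h0, Quaternion.normSq_def', h0]
    rw [show (0 : ℝ) ^ 2 + I.imI ^ 2 + I.imJ ^ 2 + I.imK ^ 2 = 1 by linarith]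
    simp

/-! ### Slices as isometric copies of the complex plane -/

/-- The parametrization of `L_I` as a homomorphism of real algebras. -/
def sliceHom (I : imaginaryUnits) : ℂ →ₐ[ℝ] ℍ[ℝ] :=
  Complex.liftAux (I : ℍ[ℝ]) ((sq (I : ℍ[ℝ])).symm.trans I.2)

theorem sliceHom_apply (I : imaginaryUnits) (z : ℂ) : sliceHom I z = slice I z := by
  simp [sliceHom, slice, Complex.liftAux_apply, Quaternion.coe_mul_eq_smul]

theorem norm_sliceHom (I : imaginaryUnits) (z : ℂ) : ‖sliceHom I z‖ = ‖z‖ := by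
  obtain ⟨h0, h1⟩ := mem_imaginaryUnits_iff.1 I.2
  rw [sliceHom_apply, ← sq_eq_sq₀ (norm_nonneg _) (norm_nonneg _), Complex.sq_norm,
    sq, ← Quaternion.normSq_eq_norm_mul_self, Quaternion.normSq_def', Complex.normSq_apply]
  simp [slice, h0]
  linear_combination z.im ^ 2 * h1

theorem sliceHom_ofReal (I : imaginaryUnits) (x : ℝ) : sliceHom I x = (x : ℍ[ℝ]) := by
  exact (sliceHom I).commutes x

theorem continuous_sliceHom (I : imaginaryUnits) : Continuous (sliceHom I) :=
  (sliceHom I).toLinearMap.continuous_of_finiteDimensional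

theorem sliceHom_injective (I : imaginaryUnits) : Function.Injective (sliceHom I) :=
  (sliceHom I).toRingHom.injective

theorem tendsto_sliceHom_cocompact (I : imaginaryUnits) :
    Filter.Tendsto (sliceHom I) (Filter.cocompact ℂ) (Filter.cocompact ℍ[ℝ]) := by
  rw [← Metric.cobounded_eq_cocompact, ← Metric.cobounded_eq_cocompact,
    ← tendsto_norm_atTop_iff_cobounded]
  simpa only [norm_sliceHom] using tendsto_norm_cobounded_atTop (E := ℂ)

/-- Every quaternion lies on some complex line `L_I`. -/
theorem exists_sliceHom_eq (q : ℍ[ℝ]) : ∃ (I : imaginaryUnits) (z : ℂ), sliceHom I z = q := by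
  set r : ℝ := √(q.imI ^ 2 + q.imJ ^ 2 + q.imK ^ 2) with hr
  have hr2 : r ^ 2 = q.imI ^ 2 + q.imJ ^ 2 + q.imK ^ 2 := Real.sq_sqrt (by positivity)
  by_cases h : r = 0
  · have hI : (⟨0, 1, 0, 0⟩ : ℍ[ℝ]) ∈ imaginaryUnits := mem_imaginaryUnits_iff.2 (by simp)
    refine ⟨⟨_, hI⟩, q.re, ?_⟩
    rw [h] at hr2
    rw [sliceHom_ofReal]
    ext <;> simp <;> nlinarith [sq_nonneg q.imI, sq_nonneg q.imJ, sq_nonneg q.imK]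
  · obtain ⟨J, h0, h1, h2, h3⟩ : ∃ J : ℍ[ℝ], J.re = 0 ∧ J.imI = q.imI / r ∧ J.imJ = q.imJ / r ∧
        J.imK = q.imK / r := ⟨⟨0, q.imI / r, q.imJ / r, q.imK / r⟩, rfl, rfl, rfl, rfl⟩
    have hJ : J ∈ imaginaryUnits := by
      refine mem_imaginaryUnits_iff.2 ⟨h0, ?_⟩
      rw [h1, h2, h3]
      field_simp
      exact hr2.symm
    refine ⟨⟨J, hJ⟩, ⟨q.re, r⟩, ?_⟩
    rw [sliceHom_apply]
    ext <;> simp [slice, h0, h1, h2, h3] <;> field_simp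

/-! ### Holomorphy on a slice -/

/-- The complex structure on `ℍ` given by left multiplication by elements of `L_I`. -/
abbrev sliceNormedSpace (I : imaginaryUnits) : NormedSpace ℂ ℍ[ℝ] :=
  { Module.compHom ℍ[ℝ] (sliceHom I).toRingHom with
    norm_smul_le := fun z q => by
      change ‖sliceHom I z * q‖ ≤ _
      rw [norm_mul, norm_sliceHom] }

/-- Holomorphy at `z` with respect to the complex structure `I` on the target. -/
def HolomorphicAt (I : imaginaryUnits) (g : ℂ → ℍ[ℝ]) (z : ℂ) : Prop :=
  letI := sliceNormedSpace I
  DifferentiableAt ℂ g z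

/-- The Cauchy-Riemann equation says that the real derivative commutes with `i`, hence is complex
linear. -/
theorem differentiableAt_complex_of_real {E : Type*} [NormedAddCommGroup E] [NormedSpace ℝ E]
    [NormedSpace ℂ E] [IsScalarTower ℝ ℂ E] {g : ℂ → E} {z : ℂ} (hd : DifferentiableAt ℝ g z)
    (h : fderiv ℝ g z 1 + Complex.I • fderiv ℝ g z Complex.I = 0) : DifferentiableAt ℂ g z := by
  have hI : fderiv ℝ g z Complex.I = Complex.I • fderiv ℝ g z 1 := by
    rw [eq_neg_of_add_eq_zero_left h, smul_neg, smul_smul, Complex.I_mul_I, neg_one_smul, neg_neg]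
  refine (hasFDerivAt_of_restrictScalars (𝕜' := ℂ)
    (f' := ContinuousLinearMap.toSpanSingleton ℂ (fderiv ℝ g z 1)) ℝ hd.hasFDerivAt
    ?_).differentiableAt
  ext w
  rw [ContinuousLinearMap.coe_restrictScalars', ContinuousLinearMap.toSpanSingleton_apply]
  conv_rhs => rw [← Complex.re_add_im w, ← mul_one (w.re : ℂ), ← Complex.real_smul,
    ← Complex.real_smul, map_add, map_smul, map_smul, hI]
  conv_lhs => rw [← Complex.re_add_im w, ← mul_one (w.re : ℂ), ← Complex.real_smul,
    ← Complex.real_smul, add_smul, smul_assoc, smul_assoc, one_smul]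

theorem holomorphicAt_of_dbar {I : imaginaryUnits} {g : ℂ → ℍ[ℝ]} {z : ℂ}
    (hd : DifferentiableAt ℝ g z) (h : dbar I g z = 0) : HolomorphicAt I g z := by
  let _ := sliceNormedSpace I
  have hsmul : ∀ (w : ℂ) (q : ℍ[ℝ]), w • q = sliceHom I w * q := fun _ _ => rfl
  have : IsScalarTower ℝ ℂ ℍ[ℝ] := ⟨fun r w q => by
    rw [hsmul, hsmul, map_smul, smul_mul_assoc]⟩
  refine differentiableAt_complex_of_real hd ?_
  rw [dbar, smul_eq_zero] at h
  have h' := h.resolve_left (by norm_num)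
  rw [hsmul]
  simpa [sliceHom_apply, slice] using h'

/-- Each `I` gives `ℍ` a different complex structure, so the standard facts are restated with that
structure kept local. -/
theorem HolomorphicAt.comp {I : imaginaryUnits} {g : ℂ → ℍ[ℝ]} {u : ℂ → ℂ} {z : ℂ}
    (hg : HolomorphicAt I g (u z)) (hu : DifferentiableAt ℂ u z) :
    HolomorphicAt I (fun w => g (u w)) z := by
  let _ := sliceNormedSpace I
  exact DifferentiableAt.comp (𝕜 := ℂ) z hg hu

theorem HolomorphicAt.sub_const {I : imaginaryUnits} {g : ℂ → ℍ[ℝ]} {z : ℂ}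
    (hg : HolomorphicAt I g z) (c : ℍ[ℝ]) : HolomorphicAt I (fun w => g w - c) z := by
  let _ := sliceNormedSpace I
  exact DifferentiableAt.sub_const (𝕜 := ℂ) hg c

theorem HolomorphicAt.congr {I : imaginaryUnits} {g g' : ℂ → ℍ[ℝ]} {z : ℂ}
    (hg : HolomorphicAt I g z) (h : g' =ᶠ[nhds z] g) : HolomorphicAt I g' z := by
  let _ := sliceNormedSpace I
  exact DifferentiableAt.congr_of_eventuallyEq (𝕜 := ℂ) hg h

/-- Liouville's theorem on a slice. -/
theorem holomorphic_eq_of_tendsto {I : imaginaryUnits} {g : ℂ → ℍ[ℝ]}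
    (hg : ∀ z, HolomorphicAt I g z) {c : ℍ[ℝ]}
    (hc : Filter.Tendsto g (Filter.cocompact ℂ) (nhds c)) (z : ℂ) : g z = c := by
  let _ := sliceNormedSpace I
  exact Differentiable.apply_eq_of_tendsto_cocompact (f := g) hg z hc

/-- Riemann's theorem on removable singularities on a slice. -/
theorem holomorphicAt_of_punctured {I : imaginaryUnits} {g : ℂ → ℍ[ℝ]} {c : ℂ}
    (hg : ∀ z ≠ c, HolomorphicAt I g z) (hc : ContinuousAt g c) : HolomorphicAt I g c := by
  let _ := sliceNormedSpace I
  refine (Complex.analyticAt_of_differentiable_on_punctured_nhds_of_continuousAt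
    (f := g) ?_ hc).differentiableAt
  filter_upwards [self_mem_nhdsWithin] with z hz using hg z hz

/-! ### Power series expansions -/

/-- The Taylor expansion on a slice. -/
theorem exists_hasSum_of_holomorphic {I : imaginaryUnits} {g : ℂ → ℍ[ℝ]}
    (hg : ∀ z, HolomorphicAt I g z) :
    ∃ a : ℕ → ℍ[ℝ], ∀ z, HasSum (fun n => sliceHom I z ^ n * a n) (g z) := by
  let _ := sliceNormedSpace I
  refine ⟨fun n => ((n.factorial : ℂ)⁻¹ • iteratedDeriv n g 0), fun z => ?_⟩
  have h := Complex.hasSum_taylorSeries_of_entire (f := g) hg 0 z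
  refine h.congr_fun fun n => ?_
  rw [sub_zero, smul_comm, ← map_pow]
  rfl

/-- The field is left general because uniqueness is needed over `ℝ`, to compare slices along their
common axis, and over `ℂ`, to identify Taylor coefficients. -/
theorem eq_of_hasSum_pow_smul {𝕜 E : Type*} [NontriviallyNormedField 𝕜] [NormedAddCommGroup E]
    [NormedSpace 𝕜 E] {a b : ℕ → E} {u : 𝕜 → E} (ha : ∀ x, HasSum (fun n => x ^ n • a n) (u x))
    (hb : ∀ x, HasSum (fun n => x ^ n • b n) (u x)) : a = b := by
  have key : ∀ c : ℕ → E, (∀ x, HasSum (fun n => x ^ n • c n) (u x)) →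
      ∃ p : FormalMultilinearSeries 𝕜 𝕜 E, (∀ n, p.coeff n = c n) ∧ HasFPowerSeriesAt u p 0 := by
    intro c hc
    obtain ⟨p, hp⟩ : ∃ p : FormalMultilinearSeries 𝕜 𝕜 E, ∀ n, p.coeff n = c n :=
      ⟨fun n => ContinuousMultilinearMap.mkPiRing 𝕜 (Fin n) (c n),
        fun n => by simp [FormalMultilinearSeries.coeff]⟩
    refine ⟨p, hp, hasFPowerSeriesAt_iff.2 (Filter.Eventually.of_forall fun x => ?_)⟩
    simpa only [zero_add, hp] using hc x
  obtain ⟨p, hp, hp'⟩ := key a ha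
  obtain ⟨r, hr, hr'⟩ := key b hb
  funext n
  rw [← hp, ← hr, hp'.eq_formalMultilinearSeries hr']

/-- A function that is holomorphic on every slice is the sum of a power series. -/
theorem exists_hasSum_of_sliceHolomorphic {h : ℍ[ℝ] → ℍ[ℝ]}
    (hh : ∀ I z, HolomorphicAt I (fun w => h (sliceHom I w)) z) :
    ∃ a : ℕ → ℍ[ℝ], ∀ q, HasSum (fun n => q ^ n * a n) (h q) := by
  choose a ha using fun I => exists_hasSum_of_holomorphic (hh I)
  -- All slices contain the real axis, where their expansions have the same sum; hence the
  -- coefficients do not depend on `I`.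
  have hreal : ∀ I (x : ℝ), HasSum (fun n => x ^ n • a I n) (h x) := by
    intro I x
    simpa only [sliceHom_ofReal, ← Quaternion.coe_pow, Quaternion.coe_mul_eq_smul] using ha I x
  obtain ⟨I₀, -, -⟩ := exists_sliceHom_eq 0
  refine ⟨a I₀, fun q => ?_⟩
  obtain ⟨I, z, rfl⟩ := exists_sliceHom_eq q
  rw [eq_of_hasSum_pow_smul (hreal I₀) (hreal I)]
  exact ha I z

/-! ### Entire functions of one complex variable -/

open Filter Topology in
/-- The coefficients of an entire function of polynomial growth of degree `m` vanish beyond `m`. -/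
theorem coeff_eq_zero_of_norm_le_pow {c : ℕ → ℂ} {u : ℂ → ℂ} (hd : Differentiable ℂ u)
    (hu : ∀ z, HasSum (fun n => z ^ n • c n) (u z)) {C R : ℝ} {m : ℕ}
    (hb : ∀ z, R ≤ ‖z‖ → ‖u z‖ ≤ C * ‖z‖ ^ m) {n : ℕ} (hn : m < n) : c n = 0 := by
  have hc : c = fun n => (n.factorial : ℂ)⁻¹ • iteratedDeriv n u 0 := by
    refine eq_of_hasSum_pow_smul hu fun z => ?_
    refine (Complex.hasSum_taylorSeries_of_entire hd 0 z).congr_fun fun n => ?_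
    rw [sub_zero, smul_comm]
  have hz : iteratedDeriv n u 0 = 0 := by
    -- Cauchy's estimate on the circle of radius `ρ`, with `ρ` tending to infinity.
    have hle : ∀ᶠ ρ : ℝ in atTop, ‖iteratedDeriv n u 0‖ ≤ n.factorial * C / ρ ^ (n - m) := by
      filter_upwards [eventually_ge_atTop R, eventually_gt_atTop 0] with ρ hρ h0
      have h := Complex.norm_iteratedDeriv_le_of_forall_mem_sphere_norm_le n h0
        (hd.diffContOnCl (s := Metric.ball 0 ρ)) (C := C * ρ ^ m) fun z hz => by
          rw [mem_sphere_zero_iff_norm] at hz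
          simpa [hz] using hb z (hz ▸ hρ)
      refine h.trans_eq ?_
      rw [← mul_assoc, ← Nat.sub_add_cancel hn.le, pow_add, Nat.sub_add_cancel hn.le,
        mul_div_mul_right _ _ (pow_pos h0 m).ne']
    have hlim : Tendsto (fun ρ : ℝ => n.factorial * C / ρ ^ (n - m)) atTop (𝓝 0) :=
      tendsto_const_nhds.div_atTop (tendsto_pow_atTop (Nat.sub_pos_of_lt hn).ne')
    exact norm_le_zero_iff.1 (ge_of_tendsto hlim hle)
  rw [hc]
  simp [hz]

/-- An entire function of polynomial growth is a polynomial. -/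
theorem exists_polynomial_of_norm_le_pow {u : ℂ → ℂ} (hd : Differentiable ℂ u) {C R : ℝ} {m : ℕ}
    (hb : ∀ z, R ≤ ‖z‖ → ‖u z‖ ≤ C * ‖z‖ ^ m) : ∃ P : Polynomial ℂ, ∀ z, u z = P.eval z := by
  have hs : ∀ z, HasSum (fun n => z ^ n • ((n.factorial : ℂ)⁻¹ • iteratedDeriv n u 0)) (u z) := by
    intro z
    refine (Complex.hasSum_taylorSeries_of_entire hd 0 z).congr_fun fun n => ?_
    rw [sub_zero, smul_comm]
  refine ⟨∑ n ∈ Finset.range (m + 1),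
    Polynomial.monomial n ((n.factorial : ℂ)⁻¹ • iteratedDeriv n u 0), fun z => ?_⟩
  have h0 : ∀ n ∉ Finset.range (m + 1),
      z ^ n • ((n.factorial : ℂ)⁻¹ • iteratedDeriv n u 0) = 0 := by
    intro n hn
    rw [coeff_eq_zero_of_norm_le_pow hd hs hb (n := n) (by simpa using hn), smul_zero]
  rw [(hs z).unique (hasSum_sum_of_ne_finset_zero h0), Polynomial.eval_finsetSum]
  exact Finset.sum_congr rfl fun n _ => by rw [Polynomial.eval_monomial, smul_eq_mul, mul_comm]

open Filter Topology in
/-- An entire function that tends to infinity at infinity and vanishes at most at `0`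
is a monomial. -/
theorem exists_eq_mul_pow_of_tendsto {φ : ℂ → ℂ} (hd : Differentiable ℂ φ)
    (ht : Tendsto (fun z => ‖φ z‖) (cocompact ℂ) atTop) (h0 : ∀ z, φ z = 0 → z = 0) :
    ∃ (m : ℕ) (c : ℂ), c ≠ 0 ∧ ∀ z ≠ 0, φ z = c * z ^ m := by
  have hne : ¬ ∀ᶠ z in 𝓝 (0 : ℂ), φ z = 0 := by
    intro h
    have h1 : ∀ᶠ z in 𝓝[≠] (0 : ℂ), φ z = 0 := h.filter_mono nhdsWithin_le_nhds
    obtain ⟨z, hz, hz'⟩ := (h1.and self_mem_nhdsWithin).exists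
    exact hz' (h0 z hz)
  obtain ⟨m, g, hg, hg0, hgφ⟩ :=
    (hd.analyticAt 0).exists_eventuallyEq_pow_smul_nonzero_iff.2 hne
  -- Here `m` is the order of `φ` at `0`, and `(g 0)⁻¹` fills the removable singularity of `z^m /
  -- φ`, so `ψ` is entire without zeros. Once `|φ| ≥ 1`, it is bounded by `|z|^m`.
  let ψ : ℂ → ℂ := fun z => if z = 0 then (g 0)⁻¹ else z ^ m / φ z
  have hψ : ∀ z ≠ 0, ψ z = z ^ m / φ z := fun z hz => if_neg hz
  have hψd : Differentiable ℂ ψ := by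
    intro z
    by_cases hz : z = 0
    · subst hz
      refine ((hg.differentiableAt).inv hg0).congr_of_eventuallyEq ?_
      filter_upwards [hgφ] with w hw
      by_cases hw0 : w = 0
      · simp [ψ, hw0]
      · rw [hψ w hw0, hw, sub_zero, smul_eq_mul, Pi.inv_apply,
          div_mul_cancel_left₀ (pow_ne_zero m hw0)]
    · refine DifferentiableAt.congr_of_eventuallyEq (f := fun z => z ^ m / φ z)
        ((differentiableAt_id.pow m).div (hd z) fun h => hz (h0 z h)) ?_
      filter_upwards [isOpen_ne.mem_nhds hz] with w hw using hψ w hw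
  have hψ0 : ∀ z, ψ z ≠ 0 := by
    intro z
    by_cases hz : z = 0
    · simpa [ψ, hz] using hg0
    · rw [hψ z hz]
      exact div_ne_zero (pow_ne_zero m hz) fun h => hz (h0 z h)
  obtain ⟨R, hR⟩ : ∃ R : ℝ, ∀ z, R ≤ ‖z‖ → 1 ≤ ‖φ z‖ := by
    have h := ht.eventually_ge_atTop 1
    rw [← Metric.cobounded_eq_cocompact, ← comap_norm_atTop, eventually_comap,
      eventually_atTop] at h
    obtain ⟨R, hR⟩ := h
    exact ⟨R, fun z hz => hR _ hz z rfl⟩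
  obtain ⟨P, hP⟩ := exists_polynomial_of_norm_le_pow hψd (C := 1) (R := max R 1) (m := m) (by
    intro z hz
    have hz0 : z ≠ 0 := norm_pos_iff.1 (lt_of_lt_of_le one_pos ((le_max_right _ _).trans hz))
    rw [hψ z hz0, norm_div, norm_pow, one_mul]
    exact div_le_self (by positivity) (hR z ((le_max_left _ _).trans hz)))
  -- A complex polynomial without roots is constant.
  have hdeg : P.degree ≤ 0 := by
    by_contra! h
    obtain ⟨z, hz⟩ := Complex.exists_root h
    exact hψ0 z ((hP z).trans hz)
  have hconst : ∀ z, ψ z = P.coeff 0 := by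
    intro z
    rw [hP, Polynomial.eq_C_of_degree_le_zero hdeg, Polynomial.eval_C, Polynomial.coeff_C_zero]
  have hc : P.coeff 0 ≠ 0 := hconst 0 ▸ hψ0 0
  refine ⟨m, (P.coeff 0)⁻¹, inv_ne_zero hc, fun z hz => ?_⟩
  have h1 := hconst z
  rw [hψ z hz] at h1
  have h2 : φ z ≠ 0 := fun h => hz (h0 z h)
  rw [← h1]
  field_simp

/-! ### Sums of squares of real polynomials -/

open Filter Polynomial in
/-- If a sum of squares of real polynomials is a monomial, then all of them are monomials of the
same degree. -/
theorem exists_eq_monomial_of_sum_sq {ι : Type*} [Fintype ι] {c : ℝ} (hc : c ≠ 0) (m : ℕ) :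
    ∀ p : ι → ℝ[X], ∑ i, p i ^ 2 = C c * X ^ m → ∃ n, ∀ i, ∃ r, p i = C r * X ^ n := by
  induction m using Nat.strong_induction_on with
  | _ m ih =>
    intro p hp
    rcases Nat.eq_zero_or_pos m with rfl | hm
    · refine ⟨0, fun i => ⟨(p i).coeff 0, ?_⟩⟩
      -- Each square is at most the constant `c`, and a bounded polynomial is constant.
      have hb : IsBoundedUnder (· ≤ ·) atTop fun x => |(p i).eval x| := by
        refine ⟨|c| + 1, eventually_map.2 (Eventually.of_forall fun x => ?_)⟩
        have h := congrArg (Polynomial.eval x) hp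
        simp only [eval_finsetSum, eval_pow, eval_C, pow_zero, mul_one] at h
        have h1 : (p i).eval x ^ 2 ≤ c := by
          rw [← h]
          exact Finset.single_le_sum (f := fun i => (p i).eval x ^ 2)
            (fun _ _ => sq_nonneg _) (Finset.mem_univ i)
        refine abs_le_of_sq_le_sq (h1.trans ?_) (by positivity)
        nlinarith [le_abs_self c, abs_nonneg c]
      have hdeg := (isBoundedUnder_abs_atTop_iff (p i)).1 hb
      rw [pow_zero, mul_one]
      exact eq_C_of_degree_le_zero hdeg
    -- At `0` the squares sum to zero, so `X` divides every `p i`; cancelling `X ^ 2` lowers `m` by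
    -- two. The case `m = 1` is excluded since `X ^ 2` divides the sum.
    · have h0 : ∀ i, (p i).eval 0 = 0 := by
        have h := congrArg (Polynomial.eval 0) hp
        simp only [eval_finsetSum, eval_pow, eval_mul, eval_C, eval_X, zero_pow hm.ne',
          mul_zero] at h
        rw [Finset.sum_eq_zero_iff_of_nonneg fun _ _ => sq_nonneg _] at h
        exact fun i => pow_eq_zero_iff two_ne_zero |>.1 (h i (Finset.mem_univ i))
      have hX : ∀ i, ∃ r, p i = X * r := fun i => by
        rw [← dvd_def, X_dvd_iff, coeff_zero_eq_eval_zero, h0]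
      choose r hr using hX
      have hsum : X ^ 2 * ∑ i, r i ^ 2 = C c * X ^ m := by
        rw [← hp, Finset.mul_sum]
        exact Finset.sum_congr rfl fun i _ => by rw [hr i, mul_pow]
      obtain hm1 | ⟨k, rfl⟩ : m = 1 ∨ ∃ k, m = k + 2 := by
        rcases Nat.lt_or_ge m 2 with h | h
        · left; omega
        · exact .inr ⟨m - 2, by omega⟩
      · exfalso
        have h := congrArg (fun q => coeff q 1) hsum
        simp [hm1, coeff_X_pow_mul'] at h
        exact hc h.symm
      · have hsum' : ∑ i, r i ^ 2 = C c * X ^ k := by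
          refine mul_left_cancel₀ (pow_ne_zero 2 (X_ne_zero (R := ℝ))) ?_
          rw [hsum]; ring
        obtain ⟨n, hn⟩ := ih k (by omega) r hsum'
        refine ⟨n + 1, fun i => ?_⟩
        obtain ⟨s, hs⟩ := hn i
        exact ⟨s, by rw [hr i, hs]; ring⟩

/-! ### The symmetrization and its modulus -/

open scoped RealInnerProductSpace in
/-- On each sphere `x + y𝕊`, a function of the form `α + I β` attains its extreme norms at a pair
of conjugate points, and the product of these norms is the modulus of the symmetrization. -/
theorem exists_imaginaryUnit_norm_mul_norm (α β : ℍ[ℝ]) : ∃ I : imaginaryUnits,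
    ‖α + I * β‖ * ‖α - I * β‖ =
      ‖((‖α‖ ^ 2 - ‖β‖ ^ 2 : ℝ) + (2 * ⟪α, β⟫ : ℝ) * Complex.I : ℂ)‖ ∧
    (‖α‖ ^ 2 + ‖β‖ ^ 2 ≤ ‖α + I * β‖ ^ 2 ∨ ‖α‖ ^ 2 + ‖β‖ ^ 2 ≤ ‖α - I * β‖ ^ 2) := by
  -- For the slice containing `α * star β`, the real and imaginary parts of `z` are `⟪α, β⟫` and
  -- `⟪α, I * β⟫`, and `|z| = ‖α‖ ‖β‖`. This evaluates both norms.
  obtain ⟨I, z, hz⟩ := exists_sliceHom_eq (α * star β)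
  obtain ⟨hI0, hI1⟩ := mem_imaginaryUnits_iff.1 I.2
  have hre : z.re = ⟪α, β⟫ := by
    rw [Quaternion.inner_def, ← hz, sliceHom_apply]
    simp [slice, hI0]
  have hI : ‖(I : ℍ[ℝ])‖ = 1 := by
    have := norm_sliceHom I Complex.I
    simpa [sliceHom_apply, slice] using this
  have him : ⟪α, I * β⟫ = z.im := by
    rw [Quaternion.inner_def, star_mul, ← mul_assoc, ← hz, sliceHom_apply]
    simp [slice, hI0]
    linear_combination z.im * hI1
  have hnorm : z.re ^ 2 + z.im ^ 2 = ‖α‖ ^ 2 * ‖β‖ ^ 2 := by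
    rw [← mul_pow, ← norm_star β, ← norm_mul, ← hz, norm_sliceHom, Complex.sq_norm,
      Complex.normSq_apply]
    ring
  have hp : ‖α + I * β‖ ^ 2 = ‖α‖ ^ 2 + ‖β‖ ^ 2 + 2 * z.im := by
    rw [norm_add_sq_real, him, norm_mul, hI]; ring
  have hm : ‖α - I * β‖ ^ 2 = ‖α‖ ^ 2 + ‖β‖ ^ 2 - 2 * z.im := by
    rw [norm_sub_sq_real, him, norm_mul, hI]; ring
  refine ⟨I, ?_, ?_⟩
  · rw [← sq_eq_sq₀ (by positivity) (norm_nonneg _), mul_pow, hp, hm, Complex.sq_norm,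
      Complex.normSq_add_mul_I, ← hre]
    linear_combination (-4) * hnorm
  · rcases le_total 0 z.im with h | h
    · left; linarith
    · right; linarith

open Filter Topology
open scoped RealInnerProductSpace

/-- The real coordinates of a quaternion. -/
def coord (i : Fin 4) : ℍ[ℝ] →L[ℝ] ℝ :=
  (EuclideanSpace.proj i).comp
    (Quaternion.linearIsometryEquivTuple.toContinuousLinearEquiv : ℍ[ℝ] →L[ℝ] _)

theorem eq_of_coord_eq {p q : ℍ[ℝ]} (h : ∀ i, coord i p = coord i q) : p = q :=
  Quaternion.linearIsometryEquivTuple.injective (PiLp.ext h)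

theorem sum_coord_mul_coord (p q : ℍ[ℝ]) : ∑ i, coord i p * coord i q = ⟪p, q⟫ := by
  rw [← Quaternion.linearIsometryEquivTuple.inner_map_map p q, PiLp.inner_apply]
  exact Finset.sum_congr rfl fun i _ => mul_comm _ _

theorem sum_coord_sq (q : ℍ[ℝ]) : ∑ i, coord i q ^ 2 = ‖q‖ ^ 2 := by
  rw [← real_inner_self_eq_norm_sq, ← sum_coord_mul_coord]
  exact Finset.sum_congr rfl fun i _ => sq _

theorem abs_coord_le (i : Fin 4) (q : ℍ[ℝ]) : |coord i q| ≤ ‖q‖ := by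
  refine abs_le_of_sq_le_sq ?_ (norm_nonneg q)
  rw [← sum_coord_sq]
  exact Finset.single_le_sum (f := fun i => coord i q ^ 2) (fun _ _ => sq_nonneg _)
    (Finset.mem_univ i)

section PowerSeries

variable {h : ℍ[ℝ] → ℍ[ℝ]} {a : ℕ → ℍ[ℝ]} (ha : ∀ q, HasSum (fun n => q ^ n * a n) (h q))

-- Convergence at the real point `r` is already absolute, since the quaternionic norm is
-- multiplicative.
include ha in
theorem summable_pow_mul_norm (r : ℝ) : Summable fun n => r ^ n * ‖a n‖ := by
  have hs := (ha r).summable.norm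
  simp only [norm_mul, norm_pow, Quaternion.norm_coe] at hs
  refine Summable.of_norm ?_
  simpa [norm_mul, norm_pow] using hs

/-- The `i`-th coordinate of a power series over `ℍ`, as a function of a complex variable. -/
def complexCoord (a : ℕ → ℍ[ℝ]) (i : Fin 4) (z : ℂ) : ℂ := ∑' n, z ^ n * (coord i (a n) : ℂ)

theorem norm_pow_mul_coord_le (a : ℕ → ℍ[ℝ]) (i : Fin 4) (n : ℕ) {z : ℂ} {r : ℝ} (hz : ‖z‖ ≤ r) :
    ‖z ^ n * (coord i (a n) : ℂ)‖ ≤ r ^ n * ‖a n‖ := by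
  rw [norm_mul, norm_pow, Complex.norm_real]
  exact mul_le_mul (pow_le_pow_left₀ (norm_nonneg z) hz n) (abs_coord_le i _) (norm_nonneg _)
    (pow_nonneg ((norm_nonneg z).trans hz) n)

include ha in
theorem hasSum_complexCoord (i : Fin 4) (z : ℂ) :
    HasSum (fun n => z ^ n * (coord i (a n) : ℂ)) (complexCoord a i z) :=
  (Summable.of_norm_bounded (summable_pow_mul_norm ha ‖z‖)
    fun n => norm_pow_mul_coord_le a i n le_rfl).hasSum

include ha in
theorem differentiable_complexCoord (i : Fin 4) : Differentiable ℂ (complexCoord a i) := by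
  intro z
  have hd : DifferentiableOn ℂ (complexCoord a i) (Metric.ball 0 (‖z‖ + 1)) := by
    refine Complex.differentiableOn_tsum_of_summable_norm (summable_pow_mul_norm ha (‖z‖ + 1))
      (fun n => by fun_prop) Metric.isOpen_ball fun n w hw => norm_pow_mul_coord_le a i n ?_
    exact (mem_ball_zero_iff.1 hw).le
  exact hd.differentiableAt (Metric.isOpen_ball.mem_nhds (by simp))

/-- The values of a regular function on the sphere `x + y𝕊` have the form `α + I β`. -/
theorem exists_stem (ha : ∀ q, HasSum (fun n => q ^ n * a n) (h q)) (z : ℂ) :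
    ∃ α β : ℍ[ℝ], (∀ I : imaginaryUnits, h (sliceHom I z) = α + I * β ∧
        h (sliceHom I (starRingEnd ℂ z)) = α - I * β) ∧
      ∀ i, complexCoord a i z = coord i α + coord i β * Complex.I := by
  have hs := summable_pow_mul_norm ha ‖z‖
  -- Splitting `z ^ n` into real and imaginary parts gives `α` and `β` independently of `I`.
  have hα : Summable fun n => (z ^ n).re • a n := by
    refine Summable.of_norm_bounded hs fun n => ?_
    rw [norm_smul, ← norm_pow]
    exact mul_le_mul_of_nonneg_right (Complex.abs_re_le_norm _) (norm_nonneg _)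
  have hβ : Summable fun n => (z ^ n).im • a n := by
    refine Summable.of_norm_bounded hs fun n => ?_
    rw [norm_smul, ← norm_pow]
    exact mul_le_mul_of_nonneg_right (Complex.abs_im_le_norm _) (norm_nonneg _)
  obtain ⟨α, hα⟩ := hα
  obtain ⟨β, hβ⟩ := hβ
  refine ⟨α, β, fun I => ⟨?_, ?_⟩, fun i => ?_⟩
  · refine (ha _).unique ((hα.add (hβ.mul_left (I : ℍ[ℝ]))).congr_fun fun n => ?_)
    rw [← map_pow, sliceHom_apply, slice, add_mul, Quaternion.coe_mul_eq_smul,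
      Quaternion.coe_mul_eq_smul, smul_mul_assoc, mul_smul_comm]
  · refine (ha _).unique ((hα.sub (hβ.mul_left (I : ℍ[ℝ]))).congr_fun fun n => ?_)
    rw [← map_pow, ← map_pow, sliceHom_apply, slice, Complex.conj_re, Complex.conj_im, add_mul,
      Quaternion.coe_mul_eq_smul, Quaternion.coe_mul_eq_smul, smul_mul_assoc, mul_smul_comm,
      neg_smul, ← sub_eq_add_neg]
  · refine (hasSum_complexCoord ha i z).unique ?_
    have h1 := Complex.hasSum_ofReal.2 ((coord i).hasSum hα)
    have h2 := (Complex.hasSum_ofReal.2 ((coord i).hasSum hβ)).mul_right Complex.I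
    refine (h1.add h2).congr_fun fun n => ?_
    simp only [map_smul, smul_eq_mul, Complex.ofReal_mul]
    conv_lhs => rw [← Complex.re_add_im (z ^ n)]
    ring

/-- The symmetrization of a power series over `ℍ`, as a function of a complex variable. -/
def complexSymmetrization (a : ℕ → ℍ[ℝ]) (z : ℂ) : ℂ := ∑ i, complexCoord a i z ^ 2

-- In terms of the stem, the symmetrization is `‖α‖² - ‖β‖² + 2⟪α, β⟫ i`, the modulus computed on
-- the sphere. The point `q` is the conjugate point of larger norm, which also dominates every
-- coordinate.
include ha in
theorem exists_norm_complexSymmetrization (z : ℂ) : ∃ p q : ℍ[ℝ], ‖p‖ = ‖z‖ ∧ ‖q‖ = ‖z‖ ∧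
    ‖complexSymmetrization a z‖ = ‖h p‖ * ‖h q‖ ∧ ∀ i, ‖complexCoord a i z‖ ≤ ‖h q‖ := by
  obtain ⟨α, β, hI, hc⟩ := exists_stem ha z
  have hsym : complexSymmetrization a z =
      ((‖α‖ ^ 2 - ‖β‖ ^ 2 : ℝ) + (2 * ⟪α, β⟫ : ℝ) * Complex.I : ℂ) := by
    rw [← sum_coord_sq α, ← sum_coord_sq β, ← sum_coord_mul_coord, complexSymmetrization,
      ← Finset.sum_sub_distrib, Finset.mul_sum, Complex.ofReal_sum, Complex.ofReal_sum,
      Finset.sum_mul, ← Finset.sum_add_distrib]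
    refine Finset.sum_congr rfl fun i _ => ?_
    rw [hc i]
    push_cast
    linear_combination (coord i β : ℂ) ^ 2 * Complex.I_sq
  have hle : ∀ i, ‖complexCoord a i z‖ ^ 2 ≤ ‖α‖ ^ 2 + ‖β‖ ^ 2 := by
    intro i
    rw [hc i, Complex.sq_norm, Complex.normSq_add_mul_I]
    exact add_le_add (sq_le_sq.2 ((abs_coord_le i α).trans (le_abs_self _)))
      (sq_le_sq.2 ((abs_coord_le i β).trans (le_abs_self _)))
  obtain ⟨I, hmul, hmax⟩ := exists_imaginaryUnit_norm_mul_norm α β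
  rw [← hsym, ← (hI I).1, ← (hI I).2] at hmul
  rw [← (hI I).1, ← (hI I).2] at hmax
  have hn : ‖sliceHom I (starRingEnd ℂ z)‖ = ‖z‖ := by rw [norm_sliceHom, Complex.norm_conj]
  rcases hmax with hmax | hmax
  · refine ⟨_, _, hn, norm_sliceHom I z, hmul.symm.trans (mul_comm _ _), fun i => ?_⟩
    exact pow_le_pow_iff_left₀ (norm_nonneg _) (norm_nonneg _) two_ne_zero |>.1
      ((hle i).trans hmax)
  · refine ⟨_, _, norm_sliceHom I z, hn, hmul.symm, fun i => ?_⟩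
    exact pow_le_pow_iff_left₀ (norm_nonneg _) (norm_nonneg _) two_ne_zero |>.1
      ((hle i).trans hmax)

/-- A regular function that tends to infinity at infinity and vanishes only at `0` is a
monomial. -/
theorem exists_eq_pow_mul (ha : ∀ q, HasSum (fun n => q ^ n * a n) (h q))
    (ht : Tendsto (fun q => ‖h q‖) (cocompact ℍ[ℝ]) atTop) (h0 : ∀ q, h q = 0 → q = 0) :
    ∃ (n : ℕ) (b : ℍ[ℝ]), ∀ q, h q = q ^ n * b := by
  have hlarge : ∀ M : ℝ, ∃ R : ℝ, ∀ q, R ≤ ‖q‖ → M ≤ ‖h q‖ := by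
    intro M
    have hM := ht.eventually_ge_atTop M
    rw [← Metric.cobounded_eq_cocompact, ← comap_norm_atTop, eventually_comap,
      eventually_atTop] at hM
    obtain ⟨R, hR⟩ := hM
    exact ⟨R, fun q hq => hR _ hq q rfl⟩
  have hφd : Differentiable ℂ (complexSymmetrization a) :=
    Differentiable.fun_sum fun i _ => (differentiable_complexCoord ha i).pow 2
  have hφt : Tendsto (fun z => ‖complexSymmetrization a z‖) (cocompact ℂ) atTop := by
    refine tendsto_atTop.2 fun M => ?_
    obtain ⟨R, hR⟩ := hlarge (max M 1)
    rw [← Metric.cobounded_eq_cocompact, ← comap_norm_atTop, eventually_comap]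
    filter_upwards [eventually_ge_atTop R] with r hr z hz
    obtain ⟨p, q, hp, hq, hmul, -⟩ := exists_norm_complexSymmetrization ha z
    have h1 := hR p (by rw [hp, hz]; exact hr)
    have h2 := hR q (by rw [hq, hz]; exact hr)
    rw [hmul]
    nlinarith [le_max_left M 1, le_max_right M 1]
  have hφ0 : ∀ z, complexSymmetrization a z = 0 → z = 0 := by
    intro z hz
    obtain ⟨p, q, hp, hq, hmul, -⟩ := exists_norm_complexSymmetrization ha z
    rw [hz, norm_zero, eq_comm, mul_eq_zero, norm_eq_zero, norm_eq_zero] at hmul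
    rcases hmul with hmul | hmul
    · rw [← norm_eq_zero, ← hp, h0 p hmul, norm_zero]
    · rw [← norm_eq_zero, ← hq, h0 q hmul, norm_zero]
  obtain ⟨m, c, hc, hφ⟩ := exists_eq_mul_pow_of_tendsto hφd hφt hφ0
  -- Once `‖h p‖ ≥ 1`, each coordinate is at most `‖h q‖ ≤ ‖h p‖ ‖h q‖ = ‖c‖ ‖z‖^m`.
  have hvanish : ∀ n, m < n → a n = 0 := by
    intro n hn
    refine eq_of_coord_eq fun i => ?_
    obtain ⟨R, hR⟩ := hlarge 1
    have := coeff_eq_zero_of_norm_le_pow (c := fun n => (coord i (a n) : ℂ))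
      (differentiable_complexCoord ha i) (hasSum_complexCoord ha i) (C := ‖c‖) (R := max R 1)
      (m := m) (fun z hz => by
        have hz0 : z ≠ 0 := norm_pos_iff.1 (lt_of_lt_of_le one_pos ((le_max_right _ _).trans hz))
        obtain ⟨p, q, hp, hq, hmul, hle⟩ := exists_norm_complexSymmetrization ha z
        have h1 := hR p (by rw [hp]; exact (le_max_left _ _).trans hz)
        rw [hφ z hz0, norm_mul, norm_pow] at hmul
        rw [hmul]
        exact (hle i).trans (le_mul_of_one_le_left (norm_nonneg _) h1)) hn
    rw [map_zero]
    exact_mod_cast this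
  let P : Fin 4 → Polynomial ℝ := fun i =>
    ∑ n ∈ Finset.range (m + 1), Polynomial.monomial n (coord i (a n))
  have hPcoeff : ∀ i n, (P i).coeff n = coord i (a n) := by
    intro i n
    simp only [P, Polynomial.finsetSum_coeff, Polynomial.coeff_monomial]
    rw [Finset.sum_ite_eq']
    split_ifs with hn
    · rfl
    · rw [hvanish n (by simpa using hn), map_zero]
  have hPeval : ∀ i (x : ℝ), complexCoord a i x = ((P i).eval x : ℝ) := by
    intro i x
    rw [(hasSum_complexCoord ha i x).unique (hasSum_sum_of_ne_finset_zero
      (s := Finset.range (m + 1)) fun n hn => by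
        rw [hvanish n (by simpa using hn), map_zero, Complex.ofReal_zero, mul_zero])]
    simp [P, Polynomial.eval_finsetSum, mul_comm]
  have hsq : ∀ x : ℝ, x ≠ 0 → ((∑ i, (P i).eval x ^ 2 : ℝ) : ℂ) = c * (x : ℂ) ^ m := by
    intro x hx
    rw [← hφ x (by exact_mod_cast hx), complexSymmetrization]
    simp [hPeval]
  -- The symmetrization is real at real points; its value at `1` is `c`.
  have hcre : c = (c.re : ℂ) := by
    have h1 := hsq 1 one_ne_zero
    rw [Complex.ofReal_one, one_pow, mul_one] at h1
    rw [← h1, Complex.ofReal_re]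
  have hpoly : ∑ i, P i ^ 2 = Polynomial.C c.re * Polynomial.X ^ m := by
    refine Polynomial.eq_of_infinite_eval_eq _ _ ((Set.infinite_univ.sdiff
      (Set.finite_singleton (0 : ℝ))).mono fun x hx => ?_)
    have h1 := hsq x hx.2
    rw [hcre] at h1
    simp only [Set.mem_ofPred_eq, Polynomial.eval_finsetSum, Polynomial.eval_pow,
      Polynomial.eval_mul, Polynomial.eval_C, Polynomial.eval_X]
    exact_mod_cast h1
  obtain ⟨n, hn⟩ := exists_eq_monomial_of_sum_sq
    (fun h => hc (by rw [hcre, h, Complex.ofReal_zero])) m P hpoly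
  refine ⟨n, a n, fun q => (ha q).unique (hasSum_single n fun k hk => ?_)⟩
  have hak : a k = 0 := by
    refine eq_of_coord_eq fun i => ?_
    obtain ⟨r, hr⟩ := hn i
    rw [← hPcoeff, hr, Polynomial.coeff_C_mul_X_pow, if_neg hk, map_zero]
  rw [hak, mul_zero]

end PowerSeries

/-! ### Injective regular functions that are proper -/

/-- A regular injective function on `ℍ` that tends to infinity at infinity is affine. -/
theorem exists_eq_mul_add_of_injective {h : ℍ[ℝ] → ℍ[ℝ]}
    (hh : ∀ I z, HolomorphicAt I (fun w => h (sliceHom I w)) z) (hinj : Function.Injective h)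
    (ht : Tendsto h (cocompact ℍ[ℝ]) (cocompact ℍ[ℝ])) :
    ∃ a : ℍ[ℝ], a ≠ 0 ∧ ∀ q, h q = q * a + h 0 := by
  obtain ⟨a, ha⟩ := exists_hasSum_of_sliceHolomorphic (h := fun q => h q - h 0)
    fun I z => (hh I z).sub_const (h 0)
  have ht' : Tendsto (fun q => ‖h q - h 0‖) (cocompact ℍ[ℝ]) atTop := by
    refine tendsto_atTop_mono (fun q => norm_sub_norm_le (h q) (h 0)) ?_
    exact tendsto_atTop_add_const_right _ _ ((tendsto_norm_cocompact_atTop (E := ℍ[ℝ])).comp ht)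
  obtain ⟨n, b, hb⟩ := exists_eq_pow_mul ha ht' fun q hq => hinj (sub_eq_zero.1 hq)
  have hn0 : n ≠ 0 := by
    rintro rfl
    have h0 := hb 0
    have h1 := hb 1
    rw [pow_zero, sub_self] at h0
    rw [pow_zero, ← h0, sub_eq_zero] at h1
    exact one_ne_zero (hinj h1)
  have hn1 : n = 1 := by
    -- If `n > 1`, a primitive `n`-th root of unity on a slice has the same image as `1`.
    by_contra hn1
    have hζ := Complex.isPrimitiveRoot_exp n hn0
    obtain ⟨I, -, -⟩ := exists_sliceHom_eq 0
    have h1 := hb 1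
    have h2 := hb (sliceHom I (Complex.exp (2 * Real.pi * Complex.I / n)))
    rw [← map_pow, hζ.pow_eq_one, map_one, one_mul] at h2
    rw [one_pow, one_mul, ← h2, sub_left_inj] at h1
    exact hζ.ne_one (by omega) (sliceHom_injective I (by rw [map_one]; exact (hinj h1).symm))
  subst hn1
  refine ⟨b, ?_, fun q => ?_⟩
  · rintro rfl
    have h1 := hb 1
    rw [mul_zero, sub_eq_zero] at h1
    exact one_ne_zero (hinj h1)
  · rw [← pow_one q, ← hb, pow_one, sub_add_cancel]

/-! ### Passing between `ℍ` and its compactification -/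

/-- The finite part of an extended quaternion (`0` at infinity). -/
def finitePart (p : HHat) : ℍ[ℝ] := p.elim 0 id

theorem coe_finitePart {p : HHat} (hp : p ≠ OnePoint.infty) : ((finitePart p : ℍ[ℝ]) : HHat) = p := by
  obtain ⟨q, rfl⟩ := OnePoint.ne_infty_iff_exists.1 hp
  rfl

/-- A finite value rules out the pole alternative, and the local function `g` agrees with the finite
part near `z`. -/
theorem IsSemiregular.holomorphicAt {f : ℍ[ℝ] → HHat} (hf : IsSemiregular f) (I : imaginaryUnits)
    (z : ℂ) (hz : f (sliceHom I z) ≠ OnePoint.infty) :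
    HolomorphicAt I (fun w => finitePart (f (sliceHom I w))) z := by
  rw [sliceHom_apply] at hz
  rcases hf I I.2 z with ⟨R, hR, g, hg, hd, hdbar⟩ | ⟨h, -⟩
  · have hball : Metric.ball z R ∈ 𝓝 z := Metric.ball_mem_nhds z hR
    refine (holomorphicAt_of_dbar (hd.differentiableAt hball)
      (hdbar z (Metric.mem_ball_self hR))).congr ?_
    filter_upwards [hball] with w hw
    rw [sliceHom_apply, hg w hw]
    rfl
  · exact absurd h hz

theorem tendsto_coe_of_continuous {f : HHat → HHat} (hf : Continuous f) :
    Tendsto (fun q : ℍ[ℝ] => f q) (cocompact ℍ[ℝ]) (𝓝 (f OnePoint.infty)) := by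
  rw [← coclosedCompact_eq_cocompact]
  exact (OnePoint.continuous_iff f).1 hf |>.1

theorem tendsto_coe_nhds_coe_iff {α : Type*} {l : Filter α} {u : α → ℍ[ℝ]} {b : ℍ[ℝ]} :
    Tendsto (fun x => (u x : HHat)) l (𝓝 (b : HHat)) ↔ Tendsto u l (𝓝 b) :=
  (OnePoint.isOpenEmbedding_coe.tendsto_nhds_iff).symm

theorem tendsto_coe_nhds_infty_iff {α : Type*} {l : Filter α} {u : α → ℍ[ℝ]} :
    Tendsto (fun x => (u x : HHat)) l (𝓝 OnePoint.infty) ↔ Tendsto u l (cocompact ℍ[ℝ]) := by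
  rw [← coclosedCompact_eq_cocompact, ← OnePoint.comap_coe_nhds_infty, tendsto_comap_iff]
  rfl

/-! ### Finite value at infinity -/

section Pole

variable {f : HHat → HHat} (hcont : Continuous f) (hinj : Function.Injective f)
  (hsemi : IsSemiregular (fun q : ℍ[ℝ] => f (q : HHat)))

include hcont hinj hsemi

/-- If `f ∞` is finite, then `f` has a pole on every slice. -/
theorem exists_pole_on_slice {b : ℍ[ℝ]} (hb : f OnePoint.infty = b) (I : imaginaryUnits) :
    ∃ z, f (sliceHom I z : ℍ[ℝ]) = OnePoint.infty := by
  by_contra! hne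
  have hlim : Tendsto (fun z => finitePart (f (sliceHom I z : ℍ[ℝ]))) (cocompact ℂ) (𝓝 b) := by
    rw [← tendsto_coe_nhds_coe_iff, ← hb]
    simp only [coe_finitePart (hne _)]
    exact (tendsto_coe_of_continuous hcont).comp (tendsto_sliceHom_cocompact I)
  -- Without a pole the restriction is entire with limit `b`, so `f 0 = b = f ∞`, against
  -- injectivity.
  have h0 := holomorphic_eq_of_tendsto (fun z => hsemi.holomorphicAt I z (hne z)) hlim 0
  have h1 := coe_finitePart (hne 0)
  rw [h0, ← hb] at h1
  exact OnePoint.infty_ne_coe _ (hinj h1)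

/-- If `f ∞` is finite, then `f` has a pole at a real point. -/
theorem exists_real_pole {b : ℍ[ℝ]} (hb : f OnePoint.infty = b) :
    ∃ x : ℝ, f ((x : ℍ[ℝ]) : HHat) = OnePoint.infty := by
  obtain ⟨i, hi0, hi1, hi2, hi3⟩ : ∃ i : ℍ[ℝ], i.re = 0 ∧ i.imI = 1 ∧ i.imJ = 0 ∧ i.imK = 0 :=
    ⟨⟨0, 1, 0, 0⟩, rfl, rfl, rfl, rfl⟩
  obtain ⟨j, hj0, hj1, hj2, hj3⟩ : ∃ j : ℍ[ℝ], j.re = 0 ∧ j.imI = 0 ∧ j.imJ = 1 ∧ j.imK = 0 :=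
    ⟨⟨0, 0, 1, 0⟩, rfl, rfl, rfl, rfl⟩
  have hi : i ∈ imaginaryUnits := mem_imaginaryUnits_iff.2 (by simp [*])
  have hj : j ∈ imaginaryUnits := mem_imaginaryUnits_iff.2 (by simp [*])
  obtain ⟨z, hz⟩ := exists_pole_on_slice hcont hinj hsemi hb ⟨i, hi⟩
  obtain ⟨w, hw⟩ := exists_pole_on_slice hcont hinj hsemi hb ⟨j, hj⟩
  -- Injectivity makes the poles on `L_i` and `L_j` the same point, and these lines meet only in
  -- `ℝ`.
  have h := OnePoint.coe_injective (hinj (hz.trans hw.symm))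
  have him := congrArg (fun q : ℍ[ℝ] => q.imI) h
  simp [sliceHom_apply, slice, hi1, hj1] at him
  refine ⟨z.re, ?_⟩
  rw [← hz, sliceHom_apply]
  simp [slice, him]

/-- If `f` has a real pole `x`, then `q ↦ f (x + q⁻¹)` is affine. -/
theorem eq_inv_mul_add_of_real_pole {b : ℍ[ℝ]} (hb : f OnePoint.infty = b) {x : ℝ}
    (hx : f ((x : ℍ[ℝ]) : HHat) = OnePoint.infty) :
    ∃ a : ℍ[ℝ], a ≠ 0 ∧ ∀ q : ℍ[ℝ], q ≠ x →
      f (q : HHat) = (((q - x)⁻¹ * a + b : ℍ[ℝ]) : HHat) := by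
  classical
  have hfin : ∀ q : ℍ[ℝ], q ≠ x → f (q : HHat) ≠ OnePoint.infty := fun q hq h =>
    hq (OnePoint.coe_injective (hinj (h.trans hx.symm)))
  have hne : ∀ q : ℍ[ℝ], q ≠ 0 → (x : ℍ[ℝ]) + q⁻¹ ≠ x := fun q hq => by simpa using hq
  -- The inversion exchanges `x` and infinity, so the value at `0` must be `f ∞ = b`. Continuity of
  -- `f` at `x` makes `h` tend to infinity; continuity at infinity makes `h` continuous at `0`.
  let h : ℍ[ℝ] → ℍ[ℝ] := fun q => if q = 0 then b else finitePart (f ((x + q⁻¹ : ℍ[ℝ]) : HHat))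
  have h_zero : h 0 = b := if_pos rfl
  have h_of_ne : ∀ q, q ≠ 0 → h q = finitePart (f ((x + q⁻¹ : ℍ[ℝ]) : HHat)) :=
    fun q hq => if_neg hq
  have h_coe : ∀ q, q ≠ 0 → ((h q : ℍ[ℝ]) : HHat) = f ((x + q⁻¹ : ℍ[ℝ]) : HHat) := fun q hq => by
    rw [h_of_ne q hq, coe_finitePart (hfin _ (hne q hq))]
  have h_inj : Function.Injective h := by
    have h_ne : ∀ q, q ≠ 0 → h q ≠ h 0 := fun q hq he => by
      have h1 := h_coe q hq
      rw [he, h_zero, ← hb] at h1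
      exact OnePoint.infty_ne_coe _ (hinj h1)
    intro p q hpq
    by_cases hp : p = 0 <;> by_cases hq : q = 0
    · rw [hp, hq]
    · exact absurd (hpq.symm.trans (congrArg h hp)) (h_ne q hq)
    · exact absurd (hpq.trans (congrArg h hq)) (h_ne p hp)
    · have h1 := congrArg (fun r : ℍ[ℝ] => (r : HHat)) hpq
      simp only [h_coe p hp, h_coe q hq] at h1
      exact inv_injective (add_left_cancel (OnePoint.coe_injective (hinj h1)))
  have h_tendsto : Tendsto h (cocompact ℍ[ℝ]) (cocompact ℍ[ℝ]) := by
    rw [← tendsto_coe_nhds_infty_iff, ← hx]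
    have hinv : Tendsto (fun q : ℍ[ℝ] => (x : ℍ[ℝ]) + q⁻¹) (cocompact ℍ[ℝ]) (𝓝 (x : ℍ[ℝ])) := by
      rw [← Metric.cobounded_eq_cocompact]
      simpa using (tendsto_const_nhds (x := (x : ℍ[ℝ]))).add
        (tendsto_inv₀_cobounded (α := ℍ[ℝ]))
    have hlim := ((hcont.comp OnePoint.continuous_coe).tendsto (x : ℍ[ℝ])).comp hinv
    refine hlim.congr' ?_
    filter_upwards [(isCompact_singleton (x := (0 : ℍ[ℝ]))).compl_mem_cocompact] with q hq
    exact (h_coe q hq).symm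
  have h_cont : ContinuousAt h 0 := by
    rw [continuousAt_iff_punctured_nhds, h_zero, ← tendsto_coe_nhds_coe_iff, ← hb]
    have hinv : Tendsto (fun q : ℍ[ℝ] => (x : ℍ[ℝ]) + q⁻¹) (𝓝[≠] 0) (cocompact ℍ[ℝ]) := by
      rw [← Metric.cobounded_eq_cocompact]
      exact (tendsto_const_add_cobounded _).comp tendsto_inv₀_nhdsNE_zero
    refine ((tendsto_coe_of_continuous hcont).comp hinv).congr' ?_
    filter_upwards [self_mem_nhdsWithin] with q hq
    exact (h_coe q hq).symm
  have h_hol_ne : ∀ (I : imaginaryUnits) (z : ℂ), z ≠ 0 →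
      HolomorphicAt I (fun w => h (sliceHom I w)) z := by
    intro I z hz
    have hslice : ∀ w, sliceHom I ((x : ℂ) + w⁻¹) = (x : ℍ[ℝ]) + (sliceHom I w)⁻¹ := fun w => by
      rw [map_add, map_inv₀, sliceHom_ofReal]
    have hnz : ∀ w : ℂ, w ≠ 0 → sliceHom I w ≠ 0 := fun w hw => (map_ne_zero (sliceHom I)).2 hw
    have hg := HolomorphicAt.comp (u := fun w : ℂ => (x : ℂ) + w⁻¹)
      (hsemi.holomorphicAt I ((x : ℂ) + z⁻¹)
        (by rw [hslice]; exact hfin _ (hne _ (hnz z hz))))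
      ((differentiableAt_inv hz).const_add _)
    refine hg.congr ?_
    filter_upwards [isOpen_ne.mem_nhds hz] with w hw
    rw [h_of_ne _ (hnz w hw), hslice]
  have h_hol : ∀ (I : imaginaryUnits) (z : ℂ), HolomorphicAt I (fun w => h (sliceHom I w)) z := by
    intro I z
    by_cases hz : z = 0
    · subst hz
      refine holomorphicAt_of_punctured (h_hol_ne I) ?_
      refine ContinuousAt.comp (g := h) ?_ (continuous_sliceHom I).continuousAt
      rwa [map_zero]
    · exact h_hol_ne I z hz
  obtain ⟨a, ha, hha⟩ := exists_eq_mul_add_of_injective h_hol h_inj h_tendsto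
  refine ⟨a, ha, fun q hq => ?_⟩
  have h1 := h_coe (q - x)⁻¹ (inv_ne_zero (sub_ne_zero.2 hq))
  rw [inv_inv, add_sub_cancel, hha, h_zero] at h1
  exact h1.symm

end Pole

/-! ### Evaluating the regular quotient -/

theorem value_quadratic (a₀ a₁ a₂ q : ℍ[ℝ]) :
    value (PowerSeries.C a₀ + PowerSeries.X * PowerSeries.C a₁ +
      PowerSeries.X ^ 2 * PowerSeries.C a₂) q = a₀ + q * a₁ + q ^ 2 * a₂ := by
  have hX : ∀ (k n : ℕ) (a : ℍ[ℝ]), PowerSeries.coeff n (PowerSeries.X ^ k * PowerSeries.C a) =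
      if n = k then a else 0 := fun k n a => by
    rw [PowerSeries.coeff_mul_C, PowerSeries.coeff_X_pow, ite_mul, one_mul, zero_mul]
  have hc : ∀ n, PowerSeries.coeff n (PowerSeries.C a₀ + PowerSeries.X * PowerSeries.C a₁ +
      PowerSeries.X ^ 2 * PowerSeries.C a₂) =
      (if n = 0 then a₀ else 0) + (if n = 1 then a₁ else 0) + if n = 2 then a₂ else 0 := fun n => by
    rw [map_add, map_add, PowerSeries.coeff_C, hX, ← pow_one PowerSeries.X, hX]
  simp only [value, hc]
  rw [tsum_eq_sum (s := Finset.range 3)]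
  · simp [Finset.sum_range_succ]
  · intro n hn
    rw [Finset.mem_range, not_lt] at hn
    rw [if_neg (by omega), if_neg (by omega), if_neg (by omega), add_zero, add_zero, mul_zero]

theorem linear_mul_linear (c d c' d' : ℍ[ℝ]) : linear c d * linear c' d' =
    PowerSeries.C (d * d') + PowerSeries.X * PowerSeries.C (c * d' + d * c') +
      PowerSeries.X ^ 2 * PowerSeries.C (c * c') := by
  have hX : ∀ F : PowerSeries ℍ[ℝ], F * PowerSeries.X = PowerSeries.X * F :=
    fun F => (PowerSeries.commute_X F).eq
  simp only [linear, map_add, map_mul, mul_add, add_mul, sq]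
  simp only [← mul_assoc, hX]
  abel

theorem value_linear_mul_linear (c d c' d' q : ℍ[ℝ]) :
    value (linear c d * linear c' d') q =
      d * d' + q * (c * d' + d * c') + q ^ 2 * (c * c') := by
  rw [linear_mul_linear, value_quadratic]

theorem conj_linear (c d : ℍ[ℝ]) : conj (linear c d) = linear (star c) (star d) := by
  ext1 n
  simp only [conj, linear, PowerSeries.coeff_mk, map_add, PowerSeries.coeff_mul_C,
    PowerSeries.coeff_X, PowerSeries.coeff_C, star_add, star_mul]
  split_ifs <;> simp

theorem conj_linear_one_neg_real (x : ℝ) :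
    conj (linear 1 (-(x : ℍ[ℝ]))) = linear 1 (-(x : ℍ[ℝ])) := by
  rw [conj_linear]; simp

/-- The regular product is pointwise here because the left factor has real, hence central,
coefficients. -/
theorem value_linear_real_mul (x : ℝ) (c d q : ℍ[ℝ]) :
    value (linear 1 (-(x : ℍ[ℝ])) * linear c d) q = (q - x) * (q * c + d) := by
  rw [value_linear_mul_linear]
  have hx : ∀ p : ℍ[ℝ], (x : ℍ[ℝ]) * p = p * x := fun p => Quaternion.coe_commutes x p
  simp only [sub_mul, mul_add, one_mul, neg_mul, mul_neg, ← mul_assoc, hx q, sq]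
  abel

/-- The matrix of the regular fractional transformation `q ↦ (q - x)⁻¹ a + b`. -/
def poleMatrix (x : ℝ) {a : ℍ[ℝ]} (b : ℍ[ℝ]) (ha : a ≠ 0) : (Matrix (Fin 2) (Fin 2) ℍ[ℝ])ˣ where
  val := !![b, 1; a - (x : ℍ[ℝ]) * b, -(x : ℍ[ℝ])]
  -- Row reduction: `x` times the first row plus the second is `(a, 0)`; scale by `a⁻¹`, then
  -- subtract `b` times the result from the first row.
  inv := !![a⁻¹ * x, a⁻¹; 1 - b * a⁻¹ * x, -(b * a⁻¹)]
  val_inv := by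
    have hx : ∀ p : ℍ[ℝ], (x : ℍ[ℝ]) * p = p * x := fun p => Quaternion.coe_commutes x p
    rw [Matrix.mul_fin_two, Matrix.one_fin_two]
    congr! <;> simp [sub_mul, mul_sub, mul_assoc, ha, hx]
  inv_val := by
    have hx : ∀ p : ℍ[ℝ], (x : ℍ[ℝ]) * p = p * x := fun p => Quaternion.coe_commutes x p
    rw [Matrix.mul_fin_two, Matrix.one_fin_two]
    congr! <;> simp [sub_mul, mul_sub, mul_assoc, ha, hx]

theorem regularFractional_poleMatrix (x : ℝ) {a : ℍ[ℝ]} (b : ℍ[ℝ]) (ha : a ≠ 0) {q : ℍ[ℝ]}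
    (hq : q ≠ x) : q ∈ fractionalDomain (poleMatrix x b ha) ∧
      regularFractional (poleMatrix x b ha) q = (q - x)⁻¹ * a + b := by
  have hqx : q - x ≠ 0 := sub_ne_zero.2 hq
  have hs : value (symmetrization (linear 1 (-(x : ℍ[ℝ])))) q = (q - x) * (q - x) := by
    rw [symmetrization, conj_linear_one_neg_real, value_linear_real_mul, mul_one, sub_eq_add_neg]
  constructor
  · change value (symmetrization (linear 1 (-(x : ℍ[ℝ])))) q ≠ 0
    rw [hs]
    exact mul_ne_zero hqx hqx
  · change (value (symmetrization (linear 1 (-(x : ℍ[ℝ])))) q)⁻¹ *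
      value (conj (linear 1 (-(x : ℍ[ℝ]))) * linear b (a - (x : ℍ[ℝ]) * b)) q = _
    rw [hs, conj_linear_one_neg_real, value_linear_real_mul, mul_inv_rev, mul_assoc,
      inv_mul_cancel_left₀ hqx,
      show q * b + (a - (x : ℍ[ℝ]) * b) = a + (q - x) * b by rw [sub_mul]; abel,
      mul_add, inv_mul_cancel_left₀ hqx]

end SliceRegular

end

/-! ### The two cases for the value at infinity -/

theorem mainTheorem3 (f : SliceRegular.HHat → SliceRegular.HHat)
    (hcont : Continuous f) (hinj : Function.Injective f)
    (hsemi : SliceRegular.IsSemiregular (fun q : ℍ[ℝ] => f (q : SliceRegular.HHat))) :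
    SliceRegular.IsRegularAffine f ∨
      ∃ (x : ℝ) (a b : ℍ[ℝ]) (A : (Matrix (Fin 2) (Fin 2) ℍ[ℝ])ˣ),
        a ≠ 0 ∧
        A.val = !![b, 1; a - (x : ℍ[ℝ]) * b, -(x : ℍ[ℝ])] ∧
        f ((x : ℍ[ℝ]) : SliceRegular.HHat) = OnePoint.infty ∧
        f OnePoint.infty = (b : SliceRegular.HHat) ∧
        ∀ q : ℍ[ℝ], q ≠ (x : ℍ[ℝ]) →
          q ∈ SliceRegular.fractionalDomain A ∧
          f (q : SliceRegular.HHat) =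
            ((SliceRegular.regularFractional A q : ℍ[ℝ]) : SliceRegular.HHat) := by
  by_cases hinf : f OnePoint.infty = OnePoint.infty
  · left
    have hfin : ∀ q : ℍ[ℝ], f (q : SliceRegular.HHat) ≠ OnePoint.infty := fun q hq =>
      OnePoint.coe_ne_infty q (hinj (hq.trans hinf.symm))
    have hcoe := fun q => SliceRegular.coe_finitePart (hfin q)
    obtain ⟨a, ha, h⟩ := SliceRegular.exists_eq_mul_add_of_injective
      (h := fun q => SliceRegular.finitePart (f q))
      (fun I z => hsemi.holomorphicAt I z (hfin _))
      (fun p q hpq => by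
        have h1 := congrArg (fun r : ℍ[ℝ] => (r : SliceRegular.HHat)) hpq
        simp only [hcoe] at h1
        exact OnePoint.coe_injective (hinj h1))
      (by
        rw [← SliceRegular.tendsto_coe_nhds_infty_iff]
        simp only [hcoe]
        simpa only [hinf] using SliceRegular.tendsto_coe_of_continuous hcont)
    exact ⟨hinf, a, _, ha, fun q => by rw [← h q, hcoe]⟩
  · right
    obtain ⟨b, hb⟩ := OnePoint.ne_infty_iff_exists.1 hinf
    obtain ⟨x, hx⟩ := SliceRegular.exists_real_pole hcont hinj hsemi hb.symm
    obtain ⟨a, ha, h⟩ := SliceRegular.eq_inv_mul_add_of_real_pole hcont hinj hsemi hb.symm hx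
    refine ⟨x, a, b, SliceRegular.poleMatrix x b ha, ha, rfl, hx, hb.symm, fun q hq => ?_⟩
    obtain ⟨h1, h2⟩ := SliceRegular.regularFractional_poleMatrix x b ha hq
    exact ⟨h1, by rw [h2, h q hq]⟩
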